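/- All graphs are finite and simple. Let $G$ be a graph and let $f$ assign a positive integer $f(v)$ to each vertex $v\in V(G)$. An $f$-coloring of $G$ is a coloring of the edges of $G$ in which, at each vertex $v$, each color appears on at most $f(v)$ of the edges incident with $v$. The minimum number of colors in an $f$-coloring of $G$ is denoted by $\chi'_f(G)$. Put $\Delta_f(G)=\max_{v\in V(G)}\lceil d_G(v)/f(v)\rceil$. The graph $G$ is $f$-Class $1$ if $\chi'_f(G)=\Delta_f(G)$. The $f$-core $G_{\Delta_f}$ is the subgraph of $G$ induced on the vertices $v$ with $d_G(v)=f(v)\,\Delta_f(G)$. A graph is unicyclic if it is connected and contains exactly one cycle. **Theorem.** Let $G$ be a connected graph and let $f:V(G)\to\{1,2,3,\dots\}$. If every connected component of $G_{\Delta_f}$ is a tree or a unicyclic graph, and $G_{\Delta_f}$ is not $2$-regular (an empty $f$-core, which has no vertices, is not regarded as $2$-regular), then $G$ is $f$-Class $1$. -/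

import Mathlib

namespace FColoring

/-- `Δ_f(G)`, the maximum over the vertices `v` of `⌈d(v) / f(v)⌉`. -/
def fMaxDegree {V : Type*} [Fintype V] (G : SimpleGraph V) [DecidableRel G.Adj]
    (f : V → ℕ) : ℕ :=
  Finset.univ.sup fun v => ⌈(G.degree v : ℚ) / (f v : ℚ)⌉₊

/-- An edge colouring `c` is an `f`-colouring if each colour appears on at most `f v` of the
edges at each vertex `v`. -/
def IsFColoring {V : Type*} (G : SimpleGraph V) (f : V → ℕ) {C : Type*}
    (c : G.edgeSet → C) : Prop :=
  ∀ (v : V) (i : C), Nat.card {e : G.edgeSet // v ∈ (e : Sym2 V) ∧ c e = i} ≤ f v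

/-- `G` can be `f`-coloured with `k` colours. -/
def FColorable {V : Type*} (G : SimpleGraph V) (f : V → ℕ) (k : ℕ) : Prop :=
  ∃ c : G.edgeSet → Fin k, IsFColoring G f c

/-- `χ'_f(G)`, the minimum number of colours in an `f`-colouring of `G`. -/
noncomputable def fChromaticIndex {V : Type*} (G : SimpleGraph V) (f : V → ℕ) : ℕ :=
  sInf {k : ℕ | FColorable G f k}

/-- For positive `f` the minimum defining `χ'_f(G)` is over a nonempty set, and is attained. -/
theorem fColorable_fChromaticIndex {V : Type*} [Finite V] (G : SimpleGraph V) (f : V → ℕ)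
    (hf : ∀ v, 0 < f v) : FColorable G f (fChromaticIndex G f) := by
  refine Nat.sInf_mem (s := {k : ℕ | FColorable G f k}) ⟨Nat.card G.edgeSet, ?_⟩
  refine ⟨Finite.equivFin G.edgeSet, fun v i => le_trans ?_ (hf v)⟩
  have : Subsingleton {e : G.edgeSet // v ∈ (e : Sym2 V) ∧ Finite.equivFin G.edgeSet e = i} :=
    ⟨fun a b => Subtype.ext ((Finite.equivFin G.edgeSet).injective
      (a.2.2.trans b.2.2.symm))⟩
  exact Finite.card_le_one_iff_subsingleton.mpr this

/-- `G` is `f`-Class 1 if `χ'_f(G) = Δ_f(G)`. -/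
def IsFClassOne {V : Type*} [Fintype V] (G : SimpleGraph V) [DecidableRel G.Adj]
    (f : V → ℕ) : Prop :=
  fChromaticIndex G f = fMaxDegree G f

/-- The set of `f`-maximum vertices, those with `d(v) = f(v) Δ_f(G)`. -/
abbrev fMaxVertices {V : Type*} [Fintype V] (G : SimpleGraph V) [DecidableRel G.Adj]
    (f : V → ℕ) : Set V :=
  {v : V | G.degree v = f v * fMaxDegree G f}

/-- The `f`-core `G_{Δ_f}`, the subgraph induced on the `f`-maximum vertices. -/
abbrev fCore {V : Type*} [Fintype V] (G : SimpleGraph V) [DecidableRel G.Adj]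
    (f : V → ℕ) : SimpleGraph (fMaxVertices G f) :=
  G.induce (fMaxVertices G f)

/-- A graph is unicyclic if it is connected and exactly one of its subgraphs is a cycle (a cycle
subgraph being the set of vertices and edges traversed by a closed walk that is a cycle). -/
def IsUnicyclic {V : Type*} (G : SimpleGraph V) : Prop :=
  G.Connected ∧ ∃! H : G.Subgraph, ∃ (v : V) (p : G.Walk v v), p.IsCycle ∧ p.toSubgraph = H

end FColoring

/-
Suppose that `G` has no `f`-colouring with `k = Δ_f(G)` colours, and let `E` be a minimal set of
edges without such a colouring. Remove an edge `xw` from `E`, colour the rest, and consider the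
vertices reached by Vizing fans at `x` that start with `xw`. If a colour `a` were missing twice at
these vertices, then, `b` being a colour missing at `x`, decompose the edges coloured `a` or `b`
into alternating trails. A trail has only two ends, so one of the ends given by the missing colours
is not on the trail starting at `x` with colour `a`; exchanging the colours on its trail makes `b`
missing at a vertex of the fan and at `x`, and shifting the colours along the fan colours `E`.
Counting missing colours gives an adjacency lemma of Vizing type: if `xw ∈ E`, then `x` has at least
`f(w) k + 1 - d_E(w)` neighbours `z ≠ w` in `E` that are saturated, meaning that `d_E(z) = f(z) k`.

Saturated vertices belong to the `f`-core, and each vertex on an edge of `E` has at least two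
saturated neighbours. As the components of the core have at most one cycle each, a count of degrees
shows that the core vertices on edges of `E` have exactly two neighbours among themselves; hence
they are all saturated, and by the adjacency lemma `d_E(w) ≥ f(w) k - 1` for every vertex `w` on an
edge of `E`. If such a `w` were on an edge of `G` outside `E`, it would be an unsaturated vertex of
the core. So no edge of `G` leaves `E`, and connectedness yields that `E` is the set of all edges of
`G`; but then the core is 2-regular.
-/

namespace FColoring

open Finset

theorem exists_involutive_pairing {α : Type*} {S T U : Finset α} (hST : Disjoint S T)
    (hUS : U ⊆ S) (hcard : #U + #T = #S) :
    ∃ τ : α → α, Function.Involutive τ ∧ (∀ e ∈ T, τ e ∈ S) ∧ (∀ e, τ e ≠ e → e ∈ S ∨ e ∈ T) ∧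
      ∀ e ∈ U, τ e = e := by
  classical
  have hcard' : #T = #(S \ U) := by rw [card_sdiff_of_subset hUS]; lia
  let φ : T ≃ (S \ U : Finset α) := equivOfCardEq hcard'
  let τ : α → α := fun e =>
    if hT : e ∈ T then φ ⟨e, hT⟩ else if hS : e ∈ S \ U then φ.symm ⟨e, hS⟩ else e
  have hdisj : ∀ e ∈ S, e ∉ T := fun e he => disjoint_left.1 hST he
  refine ⟨τ, fun e => ?_, ?_, ?_, ?_⟩ <;> grind

section Transitions

variable {V : Type*} {τ : V → Sym2 V → Sym2 V}

/-- A transition system: at each vertex `v` an involution `τ v` of the edges at `v`, which pairs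
the edges that follow each other in a decomposition into trails. An edge fixed by `τ v` is the end
of a trail at `v`; edges not containing `v` are fixed as well. -/
structure IsTransitionSystem (τ : V → Sym2 V → Sym2 V) : Prop where
  involutive : ∀ v, Function.Involutive (τ v)
  mem_of_ne : ∀ v e, τ v e ≠ e → v ∈ e

/-- The graph whose vertices are the edges, consecutive edges of a trail of `τ` being adjacent. Its
connected components are the trails. -/
def transitionGraph (τ : V → Sym2 V → Sym2 V) : SimpleGraph (Sym2 V) :=
  SimpleGraph.fromRel fun e e' => ∃ v, τ v e = e'

theorem reachable_transition (τ : V → Sym2 V → Sym2 V) (v : V) (e : Sym2 V) :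
    (transitionGraph τ).Reachable e (τ v e) := by
  by_cases h : e = τ v e
  · rw [← h]
  · exact SimpleGraph.Adj.reachable ⟨h, Or.inl ⟨v, rfl⟩⟩

theorem IsTransitionSystem.degree_add_card_ends_le_two [DecidableEq V]
    (hτ : IsTransitionSystem τ) (e : Sym2 V) [Fintype ((transitionGraph τ).neighborSet e)] :
    (transitionGraph τ).degree e + #{v ∈ e.toFinset | τ v e = e} ≤ 2 := by
  have hsub : (transitionGraph τ).neighborFinset e ⊆
      {v ∈ e.toFinset | ¬ τ v e = e}.image (τ · e) := by
    intro e' he'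
    obtain ⟨hne, ⟨v, rfl⟩ | ⟨v, rfl⟩⟩ := (SimpleGraph.mem_neighborFinset _ _ _).1 he'
    · refine mem_image.2 ⟨v, mem_filter.2 ⟨?_, hne.symm⟩, rfl⟩
      exact Sym2.mem_toFinset.2 (hτ.mem_of_ne v e hne.symm)
    · have hmove : τ v (τ v e') ≠ τ v e' := by rw [hτ.involutive v]; exact hne.symm
      refine mem_image.2 ⟨v, mem_filter.2 ⟨?_, hmove⟩, hτ.involutive v e'⟩
      exact Sym2.mem_toFinset.2 (hτ.mem_of_ne v _ hmove)
  have hdeg : (transitionGraph τ).degree e ≤ #{v ∈ e.toFinset | ¬ τ v e = e} :=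
    (card_le_card hsub).trans card_image_le
  have hends := card_filter_add_card_filter_not (s := e.toFinset) (fun v => τ v e = e)
  have htwo : #e.toFinset ≤ 2 := by rw [Sym2.card_toFinset]; split_ifs <;> lia
  lia

theorem sum_le_two_of_degree_add_le_two {W : Type*} [Fintype W] {J : SimpleGraph W}
    [DecidableRel J.Adj] (hJ : J.Connected) {g : W → ℕ} (hg : ∀ w, J.degree w + g w ≤ 2) :
    ∑ w, g w ≤ 2 := by
  classical
  have hsum : ∑ w, (J.degree w + g w) ≤ Fintype.card W * 2 :=
    sum_le_card_nsmul univ _ 2 fun w _ => hg w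
  have hconn := hJ.card_vert_le_card_edgeSet_add_one
  rw [sum_add_distrib, J.sum_degrees_eq_twice_card_edges] at hsum
  rw [Nat.card_eq_fintype_card, Nat.card_eq_fintype_card, ← SimpleGraph.edgeFinset_card] at hconn
  lia

theorem IsTransitionSystem.exists_end_not_reachable [Finite V] (hτ : IsTransitionSystem τ)
    {A : Finset (Σ _ : V, Sym2 V)} (hA : ∀ p ∈ A, p.1 ∈ p.2 ∧ τ p.1 p.2 = p.2) (hcard : 2 < #A)
    (e : Sym2 V) : ∃ p ∈ A, ¬ (transitionGraph τ).Reachable e p.2 := by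
  classical
  have := Fintype.ofFinite V
  by_contra! hreach
  let K := (transitionGraph τ).connectedComponentMk e
  have hdeg (e' : K) :
      K.toSimpleGraph.degree e' + #{v ∈ (e' : Sym2 V).toFinset | τ v e' = e'} ≤ 2 := by
    refine le_trans (Nat.add_le_add_right ?_ _) (hτ.degree_add_card_ends_le_two (e' : Sym2 V))
    refine card_le_card_of_injOn Subtype.val (fun e'' he'' => ?_) Subtype.val_injective.injOn
    have hadj : K.toSimpleGraph.Adj e' e'' := (SimpleGraph.mem_neighborFinset _ _ _).1 he''
    exact (SimpleGraph.mem_neighborFinset _ _ _).2 (K.toSimpleGraph_hom.map_adj hadj)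
  have hmem (p) (hp : p ∈ A) : p.2 ∈ K.supp :=
    SimpleGraph.ConnectedComponent.sound (hreach p hp).symm
  have hends : #A ≤ ∑ e' : K, #{v ∈ (e' : Sym2 V).toFinset | τ v e' = e'} := by
    rw [← card_sigma]
    refine card_le_card_of_surjOn (fun q => ⟨q.2, q.1⟩) fun p hp => ?_
    refine ⟨⟨⟨p.2, hmem p hp⟩, p.1⟩, ?_, rfl⟩
    simpa using hA p hp
  have hsum := sum_le_two_of_degree_add_le_two K.connected_toSimpleGraph hdeg
  lia

end Transitions

section Swap

variable {V C : Type*} [DecidableEq C]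

open Classical in
/-- The colouring obtained from `c` by exchanging the colours `p` and `q` on `X`. -/
noncomputable def swapOn (X : Set (Sym2 V)) (p q : C) (c : Sym2 V → C) : Sym2 V → C :=
  fun e => if e ∈ X then Equiv.swap p q (c e) else c e

theorem swapOn_of_notMem {X : Set (Sym2 V)} {e : Sym2 V} (he : e ∉ X) (p q : C) (c : Sym2 V → C) :
    swapOn X p q c e = c e :=
  if_neg he

theorem swapOn_comm (X : Set (Sym2 V)) (p q : C) (c : Sym2 V → C) :
    swapOn X p q c = swapOn X q p c := by
  unfold swapOn
  rw [Equiv.swap_comm]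

theorem swapOn_eq_iff {p q i : C} (hp : i ≠ p) (hq : i ≠ q) (X : Set (Sym2 V)) (c : Sym2 V → C)
    (e : Sym2 V) : swapOn X p q c e = i ↔ c e = i := by
  unfold swapOn
  split_ifs
  · rw [← Equiv.eq_symm_apply, Equiv.symm_swap, Equiv.swap_apply_of_ne_of_ne hp hq]
  · rfl

theorem swapOn_compl_eq_iff (X : Set (Sym2 V)) (p q : C) (c : Sym2 V → C) (e : Sym2 V) :
    swapOn Xᶜ p q c e = p ↔ swapOn X p q c e = q := by
  by_cases he : e ∈ X <;> simp [swapOn, he, Equiv.swap_apply_eq_iff]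

variable [DecidableEq V]

/-- The edges of `E` at `v` that have colour `i`. -/
def edgesOfColor (E : Finset (Sym2 V)) (c : Sym2 V → C) (v : V) (i : C) : Finset (Sym2 V) :=
  {e ∈ E | v ∈ e ∧ c e = i}

/-- The number of edges of `E` at `v` that have colour `i`. -/
def colorCount (E : Finset (Sym2 V)) (c : Sym2 V → C) (v : V) (i : C) : ℕ :=
  #(edgesOfColor E c v i)

/-- The number of edges of `E` at `v`. -/
def edgeDegree (E : Finset (Sym2 V)) (v : V) : ℕ :=
  #{e ∈ E | v ∈ e}

variable {E : Finset (Sym2 V)} {X : Set (Sym2 V)} {c : Sym2 V → C} {v : V} {p q i : C}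

theorem mem_edgesOfColor {e : Sym2 V} : e ∈ edgesOfColor E c v i ↔ e ∈ E ∧ v ∈ e ∧ c e = i :=
  mem_filter

theorem disjoint_edgesOfColor (hpq : p ≠ q) :
    Disjoint (edgesOfColor E c v p) (edgesOfColor E c v q) :=
  disjoint_filter.2 fun _ _ hp hq => hpq (hp.2.symm.trans hq.2)

theorem sum_colorCount [Fintype C] (E : Finset (Sym2 V)) (c : Sym2 V → C) (v : V) :
    ∑ i, colorCount E c v i = edgeDegree E v := by
  rw [edgeDegree, card_eq_sum_card_fiberwise (f := c) (t := univ) fun _ _ => by simp]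
  simp only [colorCount, edgesOfColor, filter_filter]

theorem colorCount_swapOn_of_ne (hp : i ≠ p) (hq : i ≠ q) :
    colorCount E (swapOn X p q c) v i = colorCount E c v i := by
  simp only [colorCount, edgesOfColor, swapOn_eq_iff hp hq]

theorem colorCount_swapOn_compl :
    colorCount E (swapOn Xᶜ p q c) v p = colorCount E (swapOn X p q c) v q := by
  simp only [colorCount, edgesOfColor, swapOn_compl_eq_iff]

theorem colorCount_swapOn_add (hpq : p ≠ q) :
    colorCount E (swapOn X p q c) v p + colorCount E (swapOn X p q c) v q =
      colorCount E c v p + colorCount E c v q := by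
  have hadd (c' : Sym2 V → C) : colorCount E c' v p + colorCount E c' v q =
      #{e ∈ E | v ∈ e ∧ (c' e = p ∨ c' e = q)} := by
    simp only [and_or_left, filter_or]
    exact (card_union_of_disjoint (disjoint_edgesOfColor hpq)).symm
  have hswap (e : Sym2 V) :
      swapOn X p q c e = p ∨ swapOn X p q c e = q ↔ c e = p ∨ c e = q := by
    by_cases he : e ∈ X <;> simp [swapOn, he, Equiv.swap_apply_eq_iff, or_comm]
  simp only [hadd, hswap]

open Classical in
theorem exists_injOn_edgesOfColor_swapOn (hpq : p ≠ q) {τ : Sym2 V → Sym2 V}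
    (hτ : Function.Involutive τ)
    (hpair : ∀ e ∈ edgesOfColor E c v q, τ e ∈ edgesOfColor E c v p)
    (hX : ∀ e, τ e ∈ X ↔ e ∈ X) :
    ∃ g : Sym2 V → Sym2 V, Set.InjOn g (edgesOfColor E (swapOn X p q c) v p) ∧
      ∀ e ∈ edgesOfColor E (swapOn X p q c) v p, g e ∈ edgesOfColor E c v p ∧
        (g e ∈ X → τ (g e) ≠ g e) := by
  refine ⟨fun e => if e ∈ X then τ e else e, fun e _ e' _ h => ?_, fun e he => ?_⟩
  · have := hτ.injective
    grind
  · obtain ⟨heE, hve, hce⟩ := mem_edgesOfColor.1 he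
    by_cases heX : e ∈ X
    · have heq : e ∈ edgesOfColor E c v q := by
        simp only [swapOn, heX, if_true, Equiv.swap_apply_eq_iff, Equiv.swap_apply_left] at hce
        exact mem_edgesOfColor.2 ⟨heE, hve, hce⟩
      simp only [heX, if_true]
      refine ⟨hpair e heq, fun _ hfix => ?_⟩
      rw [hτ e] at hfix
      exact disjoint_left.1 (disjoint_edgesOfColor hpq) (hfix ▸ hpair e heq) heq
    · rw [swapOn_of_notMem heX] at hce
      simpa [heX] using mem_edgesOfColor.2 ⟨heE, hve, hce⟩

theorem colorCount_swapOn_le (hpq : p ≠ q) {τ : Sym2 V → Sym2 V} (hτ : Function.Involutive τ)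
    (hpair : ∀ e ∈ edgesOfColor E c v q, τ e ∈ edgesOfColor E c v p)
    (hX : ∀ e, τ e ∈ X ↔ e ∈ X) :
    colorCount E (swapOn X p q c) v p ≤ colorCount E c v p := by
  obtain ⟨g, hinj, hg⟩ := exists_injOn_edgesOfColor_swapOn hpq hτ hpair hX
  exact card_le_card_of_injOn g (fun e he => (hg e he).1) hinj

theorem colorCount_swapOn_lt (hpq : p ≠ q) {τ : Sym2 V → Sym2 V} (hτ : Function.Involutive τ)
    (hpair : ∀ e ∈ edgesOfColor E c v q, τ e ∈ edgesOfColor E c v p)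
    (hX : ∀ e, τ e ∈ X ↔ e ∈ X) {e₀ : Sym2 V} (he₀ : e₀ ∈ edgesOfColor E c v p)
    (hfix : τ e₀ = e₀) (he₀X : e₀ ∈ X) :
    colorCount E (swapOn X p q c) v p < colorCount E c v p := by
  obtain ⟨g, hinj, hg⟩ := exists_injOn_edgesOfColor_swapOn hpq hτ hpair hX
  refine lt_of_le_of_lt (card_le_card_of_injOn g (fun e he => ?_) hinj)
    (card_erase_lt_of_mem he₀)
  refine mem_erase.2 ⟨fun h => ?_, (hg e he).1⟩
  exact (hg e he).2 (h ▸ he₀X) (h ▸ hfix)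

end Swap

section Colorings

variable {V C : Type*} [DecidableEq V] [DecidableEq C] {E : Finset (Sym2 V)} {f : V → ℕ}
  {c : Sym2 V → C}

/-- `c` is an `f`-colouring of the edges in `E`. Colourings are defined on all of `Sym2 V`, and
their values outside `E` are irrelevant. -/
def IsEdgeColoring (E : Finset (Sym2 V)) (f : V → ℕ) (c : Sym2 V → C) : Prop :=
  ∀ v i, colorCount E c v i ≤ f v

/-- The colour `i` is missing at `v`: one more edge at `v` may be given the colour `i`. -/
abbrev IsMissing (E : Finset (Sym2 V)) (f : V → ℕ) (c : Sym2 V → C) (v : V) (i : C) : Prop :=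
  colorCount E c v i < f v

/-- The edges in `E` have an `f`-colouring with the colours in `C`. -/
def IsEdgeColorable (E : Finset (Sym2 V)) (f : V → ℕ) (C : Type*) [DecidableEq C] : Prop :=
  ∃ c : Sym2 V → C, IsEdgeColoring E f c

/-- The number of further edges at `v` that may be given the colour `i`. The subtraction truncates
unless `c` is an `f`-colouring. -/
def deficiency (E : Finset (Sym2 V)) (f : V → ℕ) (c : Sym2 V → C) (v : V) (i : C) : ℕ :=
  f v - colorCount E c v i

theorem IsEdgeColoring.sum_deficiency_add_edgeDegree [Fintype C] (hc : IsEdgeColoring E f c)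
    (v : V) : ∑ i, deficiency E f c v i + edgeDegree E v = f v * Fintype.card C := by
  have hterm (i : C) : deficiency E f c v i + colorCount E c v i = f v :=
    Nat.sub_add_cancel (hc v i)
  rw [← sum_colorCount E c v, ← sum_add_distrib, sum_congr rfl fun i _ => hterm i]
  simp [mul_comm]

theorem isMissing_iff_deficiency_pos {v : V} {i : C} :
    IsMissing E f c v i ↔ 0 < deficiency E f c v i :=
  Nat.sub_pos_iff_lt.symm

end Colorings

section Kempe

variable {V C : Type*} [DecidableEq V] [DecidableEq C] {E : Finset (Sym2 V)} {f : V → ℕ}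
  {c : Sym2 V → C} {a b : C}

/-- A decomposition of the edges coloured `a` or `b` into alternating trails, any two consecutive
edges of which have different colours. At each vertex one of the two colours is the major one, and
only edges of that colour, those in `free v`, are ends of trails at `v`. -/
structure KempeSystem (E : Finset (Sym2 V)) (c : Sym2 V → C) (a b : C) where
  /-- The more frequent one of the two colours at a vertex. -/
  major : V → C
  /-- The other one of the two colours. -/
  minor : V → C
  /-- The transitions of the trails. -/
  pair : V → Sym2 V → Sym2 V
  /-- The edges with which a trail ends at a vertex. -/
  free : V → Finset (Sym2 V)
  colors_eq : ∀ v, major v = a ∧ minor v = b ∨ major v = b ∧ minor v = a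
  isTransitionSystem : IsTransitionSystem pair
  pair_mem : ∀ v, ∀ e ∈ edgesOfColor E c v (minor v), pair v e ∈ edgesOfColor E c v (major v)
  pair_eq_of_mem_free : ∀ v, ∀ e ∈ free v, pair v e = e
  free_subset : ∀ v, free v ⊆ edgesOfColor E c v (major v)
  card_free_add : ∀ v, #(free v) + colorCount E c v (minor v) = colorCount E c v (major v)

theorem exists_kempeSystem_at (hab : a ≠ b) (v : V) {F : Finset (Sym2 V)}
    (hF : F ⊆ edgesOfColor E c v a) (hcard : #F + colorCount E c v b ≤ colorCount E c v a) :
    ∃ (τ : Sym2 V → Sym2 V) (U : Finset (Sym2 V)), F ⊆ U ∧ U ⊆ edgesOfColor E c v a ∧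
      #U + colorCount E c v b = colorCount E c v a ∧ Function.Involutive τ ∧
      (∀ e ∈ edgesOfColor E c v b, τ e ∈ edgesOfColor E c v a) ∧ (∀ e, τ e ≠ e → v ∈ e) ∧
      ∀ e ∈ U, τ e = e := by
  obtain ⟨U, hFU, hUsub, hUcard⟩ :=
    exists_subsuperset_card_eq hF (Nat.le_sub_of_add_le hcard) (Nat.sub_le _ _)
  have hUadd : #U + colorCount E c v b = colorCount E c v a := by lia
  obtain ⟨τ, hinv, hmem, hmove, hfix⟩ :=
    exists_involutive_pairing (disjoint_edgesOfColor hab) hUsub hUadd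
  refine ⟨τ, U, hFU, hUsub, hUadd, hinv, hmem, fun e he => ?_, hfix⟩
  exact (hmove e he).elim (fun h => (mem_edgesOfColor.1 h).2.1) fun h => (mem_edgesOfColor.1 h).2.1

theorem exists_kempeSystem (hab : a ≠ b) {x : V} {e₀ : Sym2 V} (he₀ : e₀ ∈ edgesOfColor E c x a)
    (hlt : colorCount E c x b < colorCount E c x a) :
    ∃ K : KempeSystem E c a b, e₀ ∈ K.free x := by
  have hlocal (v : V) : ∃ (p q : C) (τ : Sym2 V → Sym2 V) (U : Finset (Sym2 V)),
      (p = a ∧ q = b ∨ p = b ∧ q = a) ∧ (v = x → e₀ ∈ U) ∧ U ⊆ edgesOfColor E c v p ∧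
      #U + colorCount E c v q = colorCount E c v p ∧ Function.Involutive τ ∧
      (∀ e ∈ edgesOfColor E c v q, τ e ∈ edgesOfColor E c v p) ∧ (∀ e, τ e ≠ e → v ∈ e) ∧
      ∀ e ∈ U, τ e = e := by
    by_cases hvx : v = x
    · subst hvx
      obtain ⟨τ, U, hU, h⟩ := exists_kempeSystem_at hab v (singleton_subset_iff.2 he₀)
        (by rw [card_singleton]; lia)
      exact ⟨a, b, τ, U, Or.inl ⟨rfl, rfl⟩, fun _ => singleton_subset_iff.1 hU, h⟩
    · rcases le_total (colorCount E c v b) (colorCount E c v a) with hle | hle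
      · obtain ⟨τ, U, -, h⟩ := exists_kempeSystem_at hab v (empty_subset _)
          (by rwa [card_empty, zero_add])
        exact ⟨a, b, τ, U, Or.inl ⟨rfl, rfl⟩, fun h => absurd h hvx, h⟩
      · obtain ⟨τ, U, -, h⟩ := exists_kempeSystem_at hab.symm v (empty_subset _)
          (by rwa [card_empty, zero_add])
        exact ⟨b, a, τ, U, Or.inr ⟨rfl, rfl⟩, fun h => absurd h hvx, h⟩
  choose p q τ U hcolors he₀U hsub hcard hinv hpair hmove hfix using hlocal
  exact ⟨⟨p, q, τ, U, hcolors, ⟨hinv, hmove⟩, hpair, hfix, hsub, hcard⟩, he₀U x rfl⟩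

namespace KempeSystem

variable (K : KempeSystem E c a b) {X : Set (Sym2 V)} {v : V} {e : Sym2 V}

/-- A set of edges that is a union of trails of `K`. -/
def IsClosed (X : Set (Sym2 V)) : Prop :=
  ∀ v e, K.pair v e ∈ X ↔ e ∈ X

theorem IsClosed.compl {K : KempeSystem E c a b} (hX : K.IsClosed X) : K.IsClosed Xᶜ :=
  fun v e => not_congr (hX v e)

theorem isClosed_setOf_reachable (e : Sym2 V) :
    K.IsClosed {e' | (transitionGraph K.pair).Reachable e e'} := fun v e' =>
  ⟨fun h => h.trans (reachable_transition K.pair v e').symm,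
    fun h => h.trans (reachable_transition K.pair v e')⟩

theorem major_ne_minor (hab : a ≠ b) (v : V) : K.major v ≠ K.minor v := by
  obtain ⟨hp, hq⟩ | ⟨hp, hq⟩ := K.colors_eq v <;> rw [hp, hq]
  exacts [hab, hab.symm]

theorem swapOn_major_minor (X : Set (Sym2 V)) (v : V) :
    swapOn X (K.major v) (K.minor v) c = swapOn X a b c := by
  obtain ⟨hp, hq⟩ | ⟨hp, hq⟩ := K.colors_eq v <;> rw [hp, hq]
  exact swapOn_comm X b a c

theorem mem_of_mem_free (he : e ∈ K.free v) : v ∈ e :=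
  (mem_edgesOfColor.1 (K.free_subset v he)).2.1

theorem minor_lt_major (he : e ∈ K.free v) :
    colorCount E c v (K.minor v) < colorCount E c v (K.major v) := by
  rw [← K.card_free_add v]
  exact Nat.lt_add_of_pos_left (card_pos.2 ⟨e, he⟩)

theorem minor_eq_right (he : e ∈ K.free v) (hle : colorCount E c v b ≤ colorCount E c v a) :
    K.minor v = b := by
  obtain ⟨-, hq⟩ | ⟨hp, hq⟩ := K.colors_eq v
  · exact hq
  · have hlt := K.minor_lt_major he
    rw [hp, hq] at hlt
    exact absurd hle hlt.not_ge

theorem major_eq_right (he : e ∈ K.free v) (hle : colorCount E c v a ≤ colorCount E c v b) :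
    K.major v = b := by
  obtain ⟨hp, hq⟩ | ⟨hp, -⟩ := K.colors_eq v
  · have hlt := K.minor_lt_major he
    rw [hp, hq] at hlt
    exact absurd hle hlt.not_ge
  · exact hp

theorem colorCount_major_swapOn_le (hab : a ≠ b) (hX : K.IsClosed X) (v : V) :
    colorCount E (swapOn X a b c) v (K.major v) ≤ colorCount E c v (K.major v) := by
  rw [← K.swapOn_major_minor X v]
  exact colorCount_swapOn_le (K.major_ne_minor hab v) (K.isTransitionSystem.involutive v)
    (K.pair_mem v) (hX v)

theorem colorCount_minor_swapOn (X : Set (Sym2 V)) (v : V) :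
    colorCount E (swapOn X a b c) v (K.minor v) =
      colorCount E (swapOn Xᶜ a b c) v (K.major v) := by
  rw [← K.swapOn_major_minor X v, ← K.swapOn_major_minor Xᶜ v, colorCount_swapOn_compl]

theorem isEdgeColoring_swapOn (hc : IsEdgeColoring E f c) (hab : a ≠ b) (hX : K.IsClosed X) :
    IsEdgeColoring E f (swapOn X a b c) := by
  intro v i
  by_cases hp : i = K.major v
  · rw [hp]
    exact (K.colorCount_major_swapOn_le hab hX v).trans (hc v _)
  by_cases hq : i = K.minor v
  · rw [hq, colorCount_minor_swapOn]
    exact (K.colorCount_major_swapOn_le hab hX.compl v).trans (hc v _)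
  · rw [← K.swapOn_major_minor X v, colorCount_swapOn_of_ne hp hq]
    exact hc v i

theorem isMissing_major_swapOn (hc : IsEdgeColoring E f c) (hab : a ≠ b) (hX : K.IsClosed X)
    (he : e ∈ K.free v) (heX : e ∈ X) : IsMissing E f (swapOn X a b c) v (K.major v) := by
  rw [IsMissing, ← K.swapOn_major_minor X v]
  exact (colorCount_swapOn_lt (K.major_ne_minor hab v) (K.isTransitionSystem.involutive v)
    (K.pair_mem v) (hX v) (K.free_subset v he) (K.pair_eq_of_mem_free v e he) heX).trans_le
    (hc v _)

theorem isMissing_minor_swapOn (hc : IsEdgeColoring E f c) (hab : a ≠ b) (hX : K.IsClosed X)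
    (he : e ∈ K.free v) (heX : e ∉ X) : IsMissing E f (swapOn X a b c) v (K.minor v) := by
  rw [IsMissing, colorCount_minor_swapOn]
  exact K.isMissing_major_swapOn hc hab hX.compl he heX

end KempeSystem

theorem exists_kempe_exchange [Finite V] (hc : IsEdgeColoring E f c) (hab : a ≠ b) {x : V}
    {e : Sym2 V} (he : e ∈ edgesOfColor E c x a) (hxa : ¬ IsMissing E f c x a)
    (hxb : IsMissing E f c x b) {Y : Finset V} (hY : ∀ y ∈ Y, ¬ IsMissing E f c y b)
    (hdef : 1 < ∑ y ∈ Y, deficiency E f c y a) :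
    ∃ u ∈ Y, ∃ X : Set (Sym2 V), e ∉ X ∧ IsEdgeColoring E f (swapOn X a b c) ∧
      IsMissing E f (swapOn X a b c) x b ∧ IsMissing E f (swapOn X a b c) u b := by
  have hlt : colorCount E c x b < colorCount E c x a := hxb.trans_le (not_lt.1 hxa)
  obtain ⟨K, heK⟩ := exists_kempeSystem hab he hlt
  have hxY : x ∉ Y := fun hx => hY x hx hxb
  have hle (y) (hy : y ∈ Y) : deficiency E f c y a ≤ #(K.free y) := by
    have hyb := hY y hy
    have hfree := K.card_free_add y
    unfold deficiency
    obtain ⟨hp, hq⟩ | ⟨hp, hq⟩ := K.colors_eq y <;> rw [hp, hq] at hfree <;> lia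
  let A : Finset (Σ _ : V, Sym2 V) := insert ⟨x, e⟩ (Y.sigma K.free)
  have hA : ∀ p ∈ A, p.2 ∈ K.free p.1 := by
    intro p hp
    obtain rfl | hp := mem_insert.1 hp
    exacts [heK, (mem_sigma.1 hp).2]
  have hcard : 2 < #A := by
    rw [card_insert_of_notMem fun h => hxY (mem_sigma.1 h).1, card_sigma]
    have := sum_le_sum hle
    lia
  obtain ⟨⟨u, e'⟩, hmem, hreach⟩ := K.isTransitionSystem.exists_end_not_reachable
    (fun p hp => ⟨K.mem_of_mem_free (hA p hp), K.pair_eq_of_mem_free _ _ (hA p hp)⟩) hcard e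
  obtain heq | hu := mem_insert.1 hmem
  · obtain ⟨-, rfl⟩ := Sigma.mk.inj_iff.1 heq
    exact (hreach .rfl).elim
  obtain ⟨huY, he'⟩ := mem_sigma.1 hu
  have hX := K.isClosed_setOf_reachable e'
  have heX : e ∉ {e'' | (transitionGraph K.pair).Reachable e' e''} := fun h => hreach h.symm
  refine ⟨u, huY, _, heX, K.isEdgeColoring_swapOn hc hab hX, ?_, ?_⟩
  · have hmissing := K.isMissing_minor_swapOn hc hab hX heK heX
    rwa [K.minor_eq_right heK hlt.le] at hmissing
  · have hle : colorCount E c u a ≤ colorCount E c u b := (hc u a).trans (not_lt.1 (hY u huY))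
    have hmissing := K.isMissing_major_swapOn hc hab hX he' (SimpleGraph.Reachable.refl e')
    rwa [K.major_eq_right he' hle] at hmissing

end Kempe

section Recolor

variable {V C : Type*} [DecidableEq V] [DecidableEq C] {E : Finset (Sym2 V)} {f : V → ℕ}
  {c : Sym2 V → C} {e e' : Sym2 V}

theorem colorCount_insert_update (he : e ∉ E) (c : Sym2 V → C) (a : C) (v : V) (i : C) :
    colorCount (insert e E) (Function.update c e a) v i =
      colorCount E c v i + if v ∈ e ∧ a = i then 1 else 0 := by
  have hsame : edgesOfColor E (Function.update c e a) v i = edgesOfColor E c v i :=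
    filter_congr fun e' he' => by rw [Function.update_of_ne (ne_of_mem_of_not_mem he' he)]
  unfold edgesOfColor at hsame
  rw [colorCount, colorCount, edgesOfColor, edgesOfColor, filter_insert, Function.update_self,
    hsame]
  split_ifs
  · exact card_insert_of_notMem fun h => he (mem_filter.1 h).1
  · rfl

theorem colorCount_erase_add (he : e ∈ E) (c : Sym2 V → C) (v : V) (i : C) :
    (colorCount (E.erase e) c v i + if v ∈ e ∧ c e = i then 1 else 0) = colorCount E c v i := by
  have hinsert := colorCount_insert_update (notMem_erase e E) c (c e) v i
  rwa [insert_erase he, Function.update_eq_self, eq_comm] at hinsert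

theorem edgeDegree_erase_add_one {v : V} (he : e ∈ E) (hv : v ∈ e) :
    edgeDegree (E.erase e) v + 1 = edgeDegree E v := by
  rw [edgeDegree, filter_erase]
  exact card_erase_add_one (mem_filter.2 ⟨he, hv⟩)

theorem edgeDegree_mono {E' : Finset (Sym2 V)} (h : E' ⊆ E) (v : V) :
    edgeDegree E' v ≤ edgeDegree E v :=
  card_le_card (filter_subset_filter _ h)

theorem IsEdgeColoring.update_of_isMissing (hc : IsEdgeColoring (E.erase e) f c) (he : e ∈ E)
    {b : C} (hb : ∀ v ∈ e, IsMissing (E.erase e) f c v b) :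
    IsEdgeColoring E f (Function.update c e b) := by
  intro v i
  have hcount := colorCount_insert_update (notMem_erase e E) c b v i
  rw [insert_erase he] at hcount
  rw [hcount]
  split_ifs with h
  · exact h.2 ▸ hb v h.1
  · exact hc v i

theorem colorCount_update_erase_add (he : e ∈ E) (he' : e' ∈ E) (hne : e ≠ e') (v : V) (i : C) :
    (colorCount (E.erase e') (Function.update c e (c e')) v i +
        if v ∈ e' ∧ c e' = i then 1 else 0) =
      colorCount (E.erase e) c v i + if v ∈ e ∧ c e' = i then 1 else 0 := by
  have hinsert : insert e ((E.erase e).erase e') = E.erase e' := by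
    rw [erase_right_comm, insert_erase (mem_erase.2 ⟨hne, he⟩)]
  have he_notMem : e ∉ (E.erase e).erase e' := fun h => notMem_erase e E (mem_of_mem_erase h)
  have hcolored := colorCount_insert_update he_notMem c (c e') v i
  have huncolored := colorCount_erase_add (mem_erase.2 ⟨hne.symm, he'⟩) c v i
  rw [hinsert] at hcolored
  lia

theorem colorCount_update_erase_le (he : e ∈ E) (he' : e' ∈ E) (hne : e ≠ e') {v : V}
    (hv : v ∈ e → v ∈ e') (i : C) :
    colorCount (E.erase e') (Function.update c e (c e')) v i ≤ colorCount (E.erase e) c v i := by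
  have hadd := colorCount_update_erase_add (c := c) he he' hne v i
  split_ifs at hadd <;> lia

theorem IsEdgeColoring.update_erase (hc : IsEdgeColoring (E.erase e) f c) (he : e ∈ E)
    (he' : e' ∈ E) (hne : e ≠ e')
    (hmissing : ∀ v ∈ e, v ∉ e' → IsMissing (E.erase e) f c v (c e')) :
    IsEdgeColoring (E.erase e') f (Function.update c e (c e')) := by
  intro v i
  by_cases hv : v ∈ e → v ∈ e'
  · exact (colorCount_update_erase_le he he' hne hv i).trans (hc v i)
  push Not at hv
  have hadd := colorCount_update_erase_add (c := c) he he' hne v i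
  have hlt := hmissing v hv.1 hv.2
  have hle := hc v i
  simp only [hv, true_and, false_and, if_false, add_zero] at hadd
  split_ifs at hadd with hi
  · subst hi
    lia
  · lia

theorem IsEdgeColoring.isEdgeColorable_of_isMissing {x w : V} {b : C}
    (hc : IsEdgeColoring (E.erase s(x, w)) f c) (he : s(x, w) ∈ E)
    (hx : IsMissing (E.erase s(x, w)) f c x b) (hw : IsMissing (E.erase s(x, w)) f c w b) :
    IsEdgeColorable E f C := by
  refine ⟨_, hc.update_of_isMissing he (b := b) fun u hu => ?_⟩
  obtain rfl | rfl := Sym2.mem_iff.1 hu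
  exacts [hx, hw]

theorem IsEdgeColoring.isEdgeColorable_of_isChain {x : V} {b : C} {l : List V} {w y : V}
    (hc : IsEdgeColoring (E.erase s(x, w)) f c) (hw : s(x, w) ∈ E) (hnodup : (w :: l).Nodup)
    (hchain : (w :: l).IsChain fun u v => s(x, v) ∈ E ∧ (IsMissing (E.erase s(x, w)) f c u b ∨
      IsMissing (E.erase s(x, w)) f c u (c s(x, v))))
    (hx : IsMissing (E.erase s(x, w)) f c x b) (hy : IsMissing (E.erase s(x, w)) f c y b)
    (hlast : (w :: l).getLast? = some y) : IsEdgeColorable E f C := by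
  induction l generalizing w c with
  | nil =>
    obtain rfl : w = y := by simpa using hlast
    exact hc.isEdgeColorable_of_isMissing hw hx hy
  | cons v l ih =>
    by_cases hwb : IsMissing (E.erase s(x, w)) f c w b
    · exact hc.isEdgeColorable_of_isMissing hw hx hwb
    obtain ⟨⟨hv, hwv⟩, hchain⟩ := List.isChain_cons_cons.1 hchain
    obtain ⟨hw_notMem, hnodup⟩ := List.nodup_cons.1 hnodup
    have hlast : (v :: l).getLast? = some y := by simpa using hlast
    have hne_of_mem : ∀ u ∈ v :: l, u ≠ w := fun u hu h => hw_notMem (h ▸ hu)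
    have hne : s(x, w) ≠ s(x, v) := fun h =>
      hne_of_mem v List.mem_cons_self (Sym2.congr_right.1 h).symm
    have hend (u) (hu : u ≠ w) : u ∈ s(x, w) → u ∈ s(x, v) := fun h =>
      (Sym2.mem_iff.1 h).elim (fun h => h ▸ Sym2.mem_mk_left x v) fun h => absurd h hu
    have hshift {u} (hu : u ∈ s(x, w) → u ∈ s(x, v)) {i : C}
        (h : IsMissing (E.erase s(x, w)) f c u i) :
        IsMissing (E.erase s(x, v)) f (Function.update c s(x, w) (c s(x, v))) u i :=
      (colorCount_update_erase_le hw hv hne hu i).trans_lt h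
    have hmem_y : y ∈ v :: l := List.mem_of_getLast? hlast
    refine ih (hc.update_erase hw hv hne ?_) hv hnodup (hchain.imp_of_mem_imp ?_)
      (hshift (fun _ => Sym2.mem_mk_left x v) hx) (hshift (hend y (hne_of_mem y hmem_y)) hy) hlast
    · intro u hu hu'
      obtain rfl : u = w := by_contra fun h => hu' (hend u h hu)
      exact hwv.resolve_left hwb
    · intro u z hu hz h
      rw [Function.update_of_ne fun h => hne_of_mem z hz (Sym2.congr_right.1 h)]
      have hu := hend u (hne_of_mem u hu)
      exact ⟨h.1, h.2.imp (hshift hu) (hshift hu)⟩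

end Recolor

theorem exists_nodup_isChain_of_reflTransGen {α : Type*} {r : α → α → Prop} {a b : α}
    (h : Relation.ReflTransGen r a b) :
    ∃ l : List α, (a :: l).Nodup ∧ (a :: l).IsChain r ∧ (a :: l).getLast? = some b := by
  induction h using Relation.ReflTransGen.head_induction_on with
  | refl => exact ⟨[], by simp⟩
  | @head a a' hr _ ih =>
    obtain ⟨l, hnodup, hchain, hlast⟩ := ih
    by_cases ha : a ∈ a' :: l
    · obtain ⟨s, t, hst⟩ := List.append_of_mem ha
      rw [hst] at hnodup hchain hlast
      refine ⟨t, hnodup.of_append_right, hchain.right_of_append, ?_⟩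
      rwa [List.getLast?_append_of_ne_nil _ (List.cons_ne_nil a t)] at hlast
    · refine ⟨a' :: l, List.nodup_cons.2 ⟨ha, hnodup⟩, hchain.cons_cons hr, ?_⟩
      rwa [List.getLast?_cons_cons]

section Fan

variable {V C : Type*} [DecidableEq V] [DecidableEq C] {E : Finset (Sym2 V)} {f : V → ℕ}
  {c c' : Sym2 V → C} {x w y : V} {R : Finset V} {b i : C}

/-- The vertices of a Vizing fan at `x` whose first edge `s(x, w)` is uncoloured: from a vertex `u`
of the fan one may proceed to any `v ∈ R` such that the colour of `s(x, v)` is missing at `u`. -/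
def IsFanVertex (E : Finset (Sym2 V)) (f : V → ℕ) (c : Sym2 V → C) (x w : V) (R : Finset V) :
    V → Prop :=
  Relation.ReflTransGen
    (fun u v => v ∈ R ∧ IsMissing (E.erase s(x, w)) f c u (c s(x, v))) w

/-- The setting in which fans are considered: `E` has no `f`-colouring, `c` is an `f`-colouring of
`E` without the edge `s(x, w)`, and `R` contains exactly one end of an edge `s(x, v)` of each colour
that `c` uses at `x`. -/
structure IsFanSystem (E : Finset (Sym2 V)) (f : V → ℕ) (c : Sym2 V → C) (x w : V)
    (R : Finset V) : Prop where
  mem_edges : s(x, w) ∈ E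
  not_isEdgeColorable : ¬ IsEdgeColorable E f C
  isEdgeColoring : IsEdgeColoring (E.erase s(x, w)) f c
  mem_erase : ∀ v ∈ R, s(x, v) ∈ E.erase s(x, w)
  injOn : Set.InjOn (fun v => c s(x, v)) R
  exists_mem : ∀ i, 0 < colorCount (E.erase s(x, w)) c x i → ∃ v ∈ R, c s(x, v) = i

theorem exists_isFanSystem [Finite V] (hw : s(x, w) ∈ E) (hE : ¬ IsEdgeColorable E f C)
    (hc : IsEdgeColoring (E.erase s(x, w)) f c) : ∃ R, IsFanSystem E f c x w R := by
  have := Fintype.ofFinite V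
  obtain ⟨R, hR, hbij⟩ := Set.exists_subset_bijOn
    {v | s(x, v) ∈ E.erase s(x, w)} (fun v => c s(x, v))
  lift R to Finset V using R.toFinite
  refine ⟨R, hw, hE, hc, fun v hv => hR hv, hbij.injOn, fun i hi => ?_⟩
  obtain ⟨e, he⟩ := card_pos.1 hi
  obtain ⟨heE, hxe, hce⟩ := mem_edgesOfColor.1 he
  obtain ⟨z, rfl⟩ := Sym2.mem_iff_exists.1 hxe
  exact hbij.surjOn ⟨z, heE, hce⟩

theorem IsFanVertex.isEdgeColorable (hy : IsFanVertex E f c x w R y) (hw : s(x, w) ∈ E)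
    (hR : ∀ v ∈ R, s(x, v) ∈ E) (hc' : IsEdgeColoring (E.erase s(x, w)) f c')
    (hstep : ∀ u, IsFanVertex E f c x w R u → ∀ v ∈ R,
      IsMissing (E.erase s(x, w)) f c u (c s(x, v)) →
      IsMissing (E.erase s(x, w)) f c' u b ∨ IsMissing (E.erase s(x, w)) f c' u (c' s(x, v)))
    (hxb : IsMissing (E.erase s(x, w)) f c' x b) (hyb : IsMissing (E.erase s(x, w)) f c' y b) :
    IsEdgeColorable E f C := by
  have hreach : Relation.ReflTransGen (fun u v => s(x, v) ∈ E ∧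
      (IsMissing (E.erase s(x, w)) f c' u b ∨
        IsMissing (E.erase s(x, w)) f c' u (c' s(x, v)))) w y := by
    clear hyb
    induction hy with
    | refl => exact .refl
    | tail hu h ih => exact ih.tail ⟨hR _ h.1, hstep _ hu _ h.1 h.2⟩
  obtain ⟨l, hnodup, hchain, hlast⟩ := exists_nodup_isChain_of_reflTransGen hreach
  exact hc'.isEdgeColorable_of_isChain hw hnodup hchain hxb hyb hlast

namespace IsFanSystem

theorem not_isMissing (hR : IsFanSystem E f c x w R) (hy : IsFanVertex E f c x w R y)
    (hx : IsMissing (E.erase s(x, w)) f c x i) : ¬ IsMissing (E.erase s(x, w)) f c y i :=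
  fun hyi => hR.not_isEdgeColorable <|
    hy.isEdgeColorable hR.mem_edges (fun v hv => mem_of_mem_erase (hR.mem_erase v hv))
      hR.isEdgeColoring (fun _ _ _ _ h => Or.inr h) hx hyi

theorem exists_isFanVertex (hR : IsFanSystem E f c x w R) (hx : 0 < f x)
    (hy : IsFanVertex E f c x w R y) (hi : IsMissing (E.erase s(x, w)) f c y i) :
    ∃ v ∈ R, c s(x, v) = i ∧ IsFanVertex E f c x w R v := by
  have hxi : ¬ IsMissing (E.erase s(x, w)) f c x i := fun h => hR.not_isMissing hy h hi
  obtain ⟨v, hv, rfl⟩ := hR.exists_mem i (hx.trans_le (not_lt.1 hxi))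
  exact ⟨v, hv, rfl, hy.tail ⟨hv, hi⟩⟩

theorem isMissing_swapOn_or (hR : IsFanSystem E f c x w R) {u v z : V} {X : Set (Sym2 V)}
    (hxb : IsMissing (E.erase s(x, w)) f c x b)
    (hz : z ∈ R) (hzX : s(x, z) ∉ X) (hu : IsFanVertex E f c x w R u) (hv : v ∈ R)
    (huv : IsMissing (E.erase s(x, w)) f c u (c s(x, v))) (hab : c s(x, z) ≠ b) :
    IsMissing (E.erase s(x, w)) f (swapOn X (c s(x, z)) b c) u b ∨
      IsMissing (E.erase s(x, w)) f (swapOn X (c s(x, z)) b c) u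
        (swapOn X (c s(x, z)) b c s(x, v)) := by
  have hvb : c s(x, v) ≠ b := fun h => hR.not_isMissing hu hxb (h ▸ huv)
  by_cases hvz : v = z
  · subst hvz
    have hsum := colorCount_swapOn_add (E := E.erase s(x, w)) (X := X) (c := c) (v := u) hab
    have hub := hR.isEdgeColoring u b
    rw [swapOn_of_notMem hzX]
    unfold IsMissing at huv ⊢
    lia
  · have hva : c s(x, v) ≠ c s(x, z) := fun h => hvz (hR.injOn hv hz h)
    right
    rwa [(swapOn_eq_iff hva hvb X c _).2 rfl, IsMissing, colorCount_swapOn_of_ne hva hvb]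

theorem sum_deficiency_le_one [Finite V] (hR : IsFanSystem E f c x w R) (hx : 0 < f x)
    (hxb : IsMissing (E.erase s(x, w)) f c x b) {F : Finset V}
    (hF : ∀ y ∈ F, IsFanVertex E f c x w R y) (a : C) :
    ∑ y ∈ F, deficiency (E.erase s(x, w)) f c y a ≤ 1 := by
  by_contra! hgt
  obtain ⟨y, hy, hpos⟩ := exists_ne_zero_of_sum_ne_zero (zero_lt_one.trans hgt).ne'
  have hya := isMissing_iff_deficiency_pos.2 (Nat.pos_of_ne_zero hpos)
  have hxa : ¬ IsMissing (E.erase s(x, w)) f c x a := fun h => hR.not_isMissing (hF y hy) h hya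
  obtain ⟨z, hz, rfl, -⟩ := hR.exists_isFanVertex hx (hF y hy) hya
  have hab : c s(x, z) ≠ b := fun h => hxa (h ▸ hxb)
  have hzmem : s(x, z) ∈ edgesOfColor (E.erase s(x, w)) c x (c s(x, z)) :=
    mem_edgesOfColor.2 ⟨hR.mem_erase z hz, Sym2.mem_mk_left x z, rfl⟩
  obtain ⟨u, hu, X, hzX, hc', hxb', hub'⟩ := exists_kempe_exchange hR.isEdgeColoring hab hzmem hxa
    hxb (fun y hy => hR.not_isMissing (hF y hy) hxb) hgt
  exact hR.not_isEdgeColorable <| (hF u hu).isEdgeColorable hR.mem_edges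
    (fun v hv => mem_of_mem_erase (hR.mem_erase v hv)) hc'
    (fun u hu v hv huv => hR.isMissing_swapOn_or hxb hz hzX hu hv huv hab) hxb' hub'

theorem sum_sum_deficiency_le [Finite V] [Fintype C] (hR : IsFanSystem E f c x w R) (hx : 0 < f x)
    (hxb : IsMissing (E.erase s(x, w)) f c x b) {F N : Finset V}
    (hF : ∀ y ∈ F, IsFanVertex E f c x w R y)
    (hN : ∀ v ∈ R, IsFanVertex E f c x w R v → v ∈ N) :
    ∑ y ∈ F, ∑ a, deficiency (E.erase s(x, w)) f c y a ≤ #N := by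
  rw [sum_comm]
  have hle : ∑ a, ∑ y ∈ F, deficiency (E.erase s(x, w)) f c y a ≤
      #{a | ∑ y ∈ F, deficiency (E.erase s(x, w)) f c y a ≠ 0} := by
    rw [← sum_filter_ne_zero, card_eq_sum_ones]
    exact sum_le_sum fun a _ => hR.sum_deficiency_le_one hx hxb hF a
  refine hle.trans (card_le_card_of_surjOn (fun v => c s(x, v)) fun a ha => ?_)
  obtain ⟨y, hy, hpos⟩ := exists_ne_zero_of_sum_ne_zero (mem_filter.1 ha).2
  have hya := isMissing_iff_deficiency_pos.2 (Nat.pos_of_ne_zero hpos)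
  obtain ⟨v, hv, hva, hfan⟩ := hR.exists_isFanVertex hx (hF y hy) hya
  exact ⟨v, hN v hv hfan, hva⟩

end IsFanSystem

theorem IsEdgeColoring.exists_isMissing [Fintype C] (hc : IsEdgeColoring E f c)
    (hx : edgeDegree E x < f x * Fintype.card C) : ∃ b, IsMissing E f c x b := by
  have hsum := hc.sum_deficiency_add_edgeDegree x
  obtain ⟨b, -, hb⟩ := exists_ne_zero_of_sum_ne_zero (s := univ)
    (f := deficiency E f c x) (by lia)
  exact ⟨b, isMissing_iff_deficiency_pos.2 (Nat.pos_of_ne_zero hb)⟩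

theorem vizing_adjacency_lemma [Fintype V] [Fintype C] (hx : 0 < f x)
    (hdeg : ∀ v, edgeDegree E v ≤ f v * Fintype.card C) (hw : s(x, w) ∈ E)
    (hE : ¬ IsEdgeColorable E f C) (hE' : IsEdgeColorable (E.erase s(x, w)) f C) :
    f w * Fintype.card C + 1 ≤ edgeDegree E w +
      #{z | z ≠ w ∧ s(x, z) ∈ E ∧ edgeDegree E z = f z * Fintype.card C} := by
  classical
  obtain ⟨c, hc⟩ := hE'
  obtain ⟨R, hR⟩ := exists_isFanSystem hw hE hc
  have hxdeg := edgeDegree_erase_add_one hw (Sym2.mem_mk_left x w)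
  have hwdeg := edgeDegree_erase_add_one hw (Sym2.mem_mk_right x w)
  obtain ⟨b, hxb⟩ := hc.exists_isMissing (x := x) (by have := hdeg x; lia)
  let N := {v ∈ R | IsFanVertex E f c x w R v}
  have hwN : w ∉ N := fun h => notMem_erase _ _ (hR.mem_erase w (mem_filter.1 h).1)
  have hsum : ∑ y ∈ insert w N, ∑ a, deficiency (E.erase s(x, w)) f c y a ≤ #N := by
    refine hR.sum_sum_deficiency_le hx hxb (fun y hy => ?_) fun v hv h => mem_filter.2 ⟨hv, h⟩
    obtain rfl | hy := mem_insert.1 hy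
    exacts [.refl, (mem_filter.1 hy).2]
  rw [sum_insert hwN] at hsum
  have hunsat : #{z ∈ N | ¬ edgeDegree E z = f z * Fintype.card C} ≤
      ∑ y ∈ N, ∑ a, deficiency (E.erase s(x, w)) f c y a := by
    rw [card_filter]
    refine sum_le_sum fun y _ => ?_
    have := hc.sum_deficiency_add_edgeDegree y
    have := edgeDegree_mono (erase_subset s(x, w) E) y
    have := hdeg y
    split_ifs <;> lia
  have hsat : #{z ∈ N | edgeDegree E z = f z * Fintype.card C} ≤
      #{z | z ≠ w ∧ s(x, z) ∈ E ∧ edgeDegree E z = f z * Fintype.card C} := by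
    refine card_le_card fun z hz => ?_
    obtain ⟨hzN, hz⟩ := mem_filter.1 hz
    have hzE := mem_of_mem_erase (hR.mem_erase z (mem_filter.1 hzN).1)
    exact mem_filter.2 ⟨mem_univ z, ne_of_mem_of_not_mem hzN hwN, hzE, hz⟩
  have hsplit := card_filter_add_card_filter_not (s := N)
    (fun z => edgeDegree E z = f z * Fintype.card C)
  have := hc.sum_deficiency_add_edgeDegree w
  lia

end Fan

section Pseudoforest

/-- A graph is a pseudoforest if each of its components has at most one cycle. This is expressed by
saying that the component becomes acyclic when a suitable set of at most one edge is deleted. -/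
def IsPseudoforest {W : Type*} (J : SimpleGraph W) : Prop :=
  ∀ K : J.ConnectedComponent,
    ∃ s : Set (Sym2 K), s.Subsingleton ∧ (K.toSimpleGraph.deleteEdges s).IsAcyclic

theorem IsUnicyclic.exists_isAcyclic_deleteEdges {W : Type*} {J : SimpleGraph W}
    (h : IsUnicyclic J) : ∃ e, (J.deleteEdges {e}).IsAcyclic := by
  obtain ⟨-, H, ⟨v, p, hp, rfl⟩, huniq⟩ := h
  obtain ⟨e, he⟩ := List.exists_mem_of_ne_nil p.edges
    (SimpleGraph.Walk.edges_eq_nil.not.2 hp.not_nil)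
  refine ⟨e, fun u q hq => ?_⟩
  have hle : J.deleteEdges {e} ≤ J := J.deleteEdges_le _
  have hsame : (q.mapLe hle).toSubgraph = p.toSubgraph :=
    huniq _ ⟨u, q.mapLe hle, hq.mapLe hle, rfl⟩
  have he_map : e ∈ (q.mapLe hle).edges := by
    rwa [← SimpleGraph.Walk.mem_edges_toSubgraph, hsame, SimpleGraph.Walk.mem_edges_toSubgraph]
  have he_q : e ∈ q.edges := by simpa using he_map
  have he_deleted := q.edges_subset_edgeSet he_q
  rw [SimpleGraph.edgeSet_deleteEdges] at he_deleted
  exact he_deleted.2 rfl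

theorem isPseudoforest_of_isTree_or_isUnicyclic {W : Type*} {J : SimpleGraph W}
    (h : ∀ K : J.ConnectedComponent, K.toSimpleGraph.IsTree ∨ IsUnicyclic K.toSimpleGraph) :
    IsPseudoforest J := by
  intro K
  obtain hK | hK := h K
  · exact ⟨∅, Set.subsingleton_empty, by simpa using hK.isAcyclic⟩
  · obtain ⟨e, he⟩ := hK.exists_isAcyclic_deleteEdges
    exact ⟨{e}, Set.subsingleton_singleton, he⟩

theorem card_edgeFinset_lt_card_of_isAcyclic {W : Type*} [Fintype W] [Nonempty W]
    {J : SimpleGraph W} [Fintype J.edgeSet] (hJ : J.IsAcyclic) :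
    #J.edgeFinset < Fintype.card W := by
  classical
  obtain ⟨T, hJT, -, hT⟩ :=
    SimpleGraph.connected_top.exists_isTree_le_of_le_of_isAcyclic (le_top : J ≤ ⊤) hJ
  rw [← hT.card_edgeFinset, Nat.lt_succ_iff]
  gcongr

theorem isRegularOfDegree_two_of_isAcyclic_deleteEdges {W : Type*} [Fintype W]
    {J : SimpleGraph W} [DecidableRel J.Adj] {s : Set (Sym2 W)} (hs : s.Subsingleton)
    (hJ : (J.deleteEdges s).IsAcyclic) (hdeg : ∀ w, 2 ≤ J.degree w) :
    J.IsRegularOfDegree 2 := by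
  classical
  intro w
  have : Nonempty W := ⟨w⟩
  lift s to Finset (Sym2 W) using hs.finite
  have hacyclic := card_edgeFinset_lt_card_of_isAcyclic hJ
  rw [SimpleGraph.edgeFinset_deleteEdges] at hacyclic
  have hs_card : #s ≤ 1 := card_le_one_iff_subsingleton_coe.2 hs.coe_sort
  have hedges := card_le_card_sdiff_add_card (s := J.edgeFinset) (t := s)
  have hsum : ∑ v, J.degree v ≤ ∑ _v : W, 2 := by
    rw [J.sum_degrees_eq_twice_card_edges, sum_const, card_univ, smul_eq_mul]
    lia
  have heq := (sum_eq_sum_iff_of_le fun v _ => hdeg v).1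
    (le_antisymm (sum_le_sum fun v _ => hdeg v) hsum)
  exact (heq w (mem_univ w)).symm

theorem IsPseudoforest.card_adj_eq_two {V : Type*} {G : SimpleGraph V}
    [DecidableRel G.Adj] {S : Set V} (hS : IsPseudoforest (G.induce S)) {D : Finset V}
    (hDS : ∀ d ∈ D, d ∈ S) (hD : ∀ d ∈ D, 2 ≤ #{z ∈ D | G.Adj d z}) {d : V} (hd : d ∈ D) :
    #{z ∈ D | G.Adj d z} = 2 := by
  classical
  let K := (G.induce S).connectedComponentMk ⟨d, hDS d hd⟩
  obtain ⟨s, hs, hacyclic⟩ := hS K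
  let T : Set K := {u | ((u : S) : V) ∈ D}
  let toV : T → V := fun u => u.1.1.1
  have htoV : Function.Injective toV := fun u v h => Subtype.ext (Subtype.ext (Subtype.ext h))
  have : Finite T := Finite.of_injective (fun u => (⟨toV u, u.2⟩ : D))
    fun u v h => htoV (Subtype.mk.inj h)
  have := Fintype.ofFinite T
  let J : SimpleGraph T := K.toSimpleGraph.induce T
  have hJ : (J.deleteEdges (Sym2.map Subtype.val ⁻¹' s)).IsAcyclic :=
    (hacyclic.induce T).anti fun u v h => by simpa [J] using h
  have hdegree (u : T) : J.degree u = #{z ∈ D | G.Adj (toV u) z} := by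
    rw [← SimpleGraph.card_neighborFinset_eq_degree]
    refine card_bij (fun v _ => toV v) (fun v hv => ?_) (fun v _ v' _ h => htoV h)
      fun z hz => ?_
    · exact mem_filter.2 ⟨v.2, (J.mem_neighborFinset u v).1 hv⟩
    · obtain ⟨hzD, hz⟩ := mem_filter.1 hz
      have hzK : (⟨z, hDS z hzD⟩ : S) ∈ K.supp :=
        (K.mem_supp_congr_adj (v := u.1.1) (w := ⟨z, hDS z hzD⟩) hz).1 u.1.2
      exact ⟨⟨⟨⟨z, hDS z hzD⟩, hzK⟩, hzD⟩, (J.mem_neighborFinset _ _).2 hz, rfl⟩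
  have hregular := isRegularOfDegree_two_of_isAcyclic_deleteEdges
    (hs.preimage (Sym2.map.injective Subtype.val_injective)) hJ
    fun u => (hdegree u).symm ▸ hD (toV u) u.2
  exact (hdegree ⟨⟨⟨d, hDS d hd⟩, rfl⟩, hd⟩).symm.trans (hregular _)

end Pseudoforest

section Critical

variable {V : Type*} [DecidableEq V] {E : Finset (Sym2 V)} {f : V → ℕ} {k : ℕ} {v w x : V}

/-- An edge set is critical for `k` colours if it has no `f`-colouring with `k` colours but each of
its proper subsets has one. -/
def IsCritical (E : Finset (Sym2 V)) (f : V → ℕ) (k : ℕ) : Prop :=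
  Minimal (fun E => ¬ IsEdgeColorable E f (Fin k)) E

theorem exists_isCritical_subset (hE : ¬ IsEdgeColorable E f (Fin k)) :
    ∃ E' ⊆ E, IsCritical E' f k :=
  exists_minimal_le_of_wellFoundedLT _ E hE

theorem IsCritical.isEdgeColorable_erase (hE : IsCritical E f k) {e : Sym2 V} (he : e ∈ E) :
    IsEdgeColorable (E.erase e) f (Fin k) :=
  not_not.1 (hE.not_prop_of_lt (erase_ssubset he))

theorem IsCritical.nonempty (hE : IsCritical E f k) (hk : 0 < k) : E.Nonempty := by
  rw [nonempty_iff_ne_empty]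
  rintro rfl
  exact hE.prop ⟨fun _ => ⟨0, hk⟩, fun _ _ => Nat.zero_le _⟩

theorem edgeDegree_pos_iff : 0 < edgeDegree E v ↔ ∃ w, s(v, w) ∈ E := by
  refine card_pos.trans ⟨fun ⟨e, he⟩ => ?_, fun ⟨w, hw⟩ => ⟨_, mem_filter.2 ⟨hw, by simp⟩⟩⟩
  obtain ⟨heE, hve⟩ := mem_filter.1 he
  obtain ⟨w, rfl⟩ := Sym2.mem_iff_exists.1 hve
  exact ⟨w, heE⟩

variable [Fintype V]

/-- The vertices at which every colour must appear `f v` times in an `f`-colouring of `E` with `k`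
colours. -/
def saturatedVertices (E : Finset (Sym2 V)) (f : V → ℕ) (k : ℕ) : Finset V :=
  {v | edgeDegree E v = f v * k}

theorem mem_saturatedVertices : v ∈ saturatedVertices E f k ↔ edgeDegree E v = f v * k := by
  simp [saturatedVertices]

namespace IsCritical

theorem lt_edgeDegree_add_card_saturated (hE : IsCritical E f k) (hx : 0 < f x)
    (hdeg : ∀ v, edgeDegree E v ≤ f v * k) (hxw : s(x, w) ∈ E) :
    f w * k < edgeDegree E w + #{z ∈ saturatedVertices E f k | z ≠ w ∧ s(x, z) ∈ E} := by
  have hadj := vizing_adjacency_lemma hx (by simpa using hdeg) hxw hE.prop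
    (hE.isEdgeColorable_erase hxw)
  simp only [Fintype.card_fin] at hadj
  refine hadj.trans (Nat.add_le_add_left (card_le_card fun z hz => ?_) _)
  obtain ⟨hne, hxz, hz⟩ := (mem_filter.1 hz).2
  exact mem_filter.2 ⟨mem_saturatedVertices.2 hz, hne, hxz⟩

theorem exists_saturated_ne (hE : IsCritical E f k) (hx : 0 < f x)
    (hdeg : ∀ v, edgeDegree E v ≤ f v * k) (hxw : s(x, w) ∈ E) :
    ∃ m ∈ saturatedVertices E f k, m ≠ w ∧ s(x, m) ∈ E := by
  have hlt := hE.lt_edgeDegree_add_card_saturated hx hdeg hxw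
  have hle := hdeg w
  obtain ⟨m, hm⟩ := card_pos.1
    (show 0 < #{z ∈ saturatedVertices E f k | z ≠ w ∧ s(x, z) ∈ E} by lia)
  exact ⟨m, mem_filter.1 hm⟩

theorem two_le_card_saturated (hE : IsCritical E f k) (hx : 0 < f x)
    (hdeg : ∀ v, edgeDegree E v ≤ f v * k) (hpos : 0 < edgeDegree E x) :
    2 ≤ #{z ∈ saturatedVertices E f k | s(x, z) ∈ E} := by
  obtain ⟨w, hxw⟩ := edgeDegree_pos_iff.1 hpos
  obtain ⟨m, hm, -, hxm⟩ := hE.exists_saturated_ne hx hdeg hxw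
  obtain ⟨m', hm', hne, hxm'⟩ := hE.exists_saturated_ne hx hdeg hxm
  exact one_lt_card.2 ⟨m, mem_filter.2 ⟨hm, hxm⟩, m', mem_filter.2 ⟨hm', hxm'⟩, hne.symm⟩

end IsCritical

variable {G : SimpleGraph V} [DecidableRel G.Adj]

theorem edgeDegree_edgeFinset (v : V) : edgeDegree G.edgeFinset v = G.degree v := by
  rw [edgeDegree, ← G.incidenceFinset_eq_filter, G.card_incidenceFinset_eq_degree]

theorem edgeDegree_le_degree (hEG : E ⊆ G.edgeFinset) (v : V) : edgeDegree E v ≤ G.degree v :=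
  (edgeDegree_mono hEG v).trans (edgeDegree_edgeFinset v).le

theorem mk_mem_of_edgeDegree_eq_degree (hEG : E ⊆ G.edgeFinset)
    (hv : edgeDegree E v = G.degree v) (hvw : G.Adj v w) : s(v, w) ∈ E := by
  rw [← edgeDegree_edgeFinset] at hv
  have heq := eq_of_subset_of_card_le (filter_subset_filter (v ∈ ·) hEG) hv.ge
  have hmem : s(v, w) ∈ {e ∈ G.edgeFinset | v ∈ e} :=
    mem_filter.2 ⟨SimpleGraph.mem_edgeFinset.2 hvw, Sym2.mem_mk_left v w⟩
  exact (mem_filter.1 (heq ▸ hmem)).1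

theorem edgeDegree_eq_degree_of_connected (hG : G.Connected) (hEG : E ⊆ G.edgeFinset)
    (hE : E.Nonempty) (hclosed : ∀ v, 0 < edgeDegree E v → edgeDegree E v = G.degree v) (v : V) :
    edgeDegree E v = G.degree v := by
  obtain ⟨⟨a, b⟩, hab⟩ := hE
  refine hclosed v ?_
  have hreach := (SimpleGraph.reachable_iff_reflTransGen a v).1 (hG.preconnected a v)
  induction hreach with
  | refl => exact edgeDegree_pos_iff.2 ⟨b, hab⟩
  | @tail u u' _ huu' ih =>
    refine edgeDegree_pos_iff.2 ⟨u, ?_⟩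
    rw [Sym2.eq_swap]
    exact mk_mem_of_edgeDegree_eq_degree hEG (hclosed u ih) huu'

theorem degree_eq_and_edgeDegree_pos_of_mem_saturated (hEG : E ⊆ G.edgeFinset)
    (hf : ∀ v, 0 < f v) (hk : 0 < k) (hdeg : ∀ v, G.degree v ≤ f v * k)
    (hv : v ∈ saturatedVertices E f k) : G.degree v = f v * k ∧ 0 < edgeDegree E v := by
  rw [mem_saturatedVertices] at hv
  exact ⟨le_antisymm (hdeg v) (hv ▸ edgeDegree_le_degree hEG v), hv ▸ Nat.mul_pos (hf v) hk⟩

theorem saturated_neighbors_subset (hEG : E ⊆ G.edgeFinset) (hf : ∀ v, 0 < f v) (hk : 0 < k)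
    (hdeg : ∀ v, G.degree v ≤ f v * k) (v : V) :
    {z ∈ saturatedVertices E f k | s(v, z) ∈ E} ⊆
      ({z | (G.degree z = f z * k ∧ 0 < edgeDegree E z) ∧ G.Adj v z} : Finset V) := by
  intro z hz
  obtain ⟨hz, hvz⟩ := mem_filter.1 hz
  exact mem_filter.2 ⟨mem_univ z,
    degree_eq_and_edgeDegree_pos_of_mem_saturated hEG hf hk hdeg hz,
    SimpleGraph.mem_edgeFinset.1 (hEG hvz)⟩

namespace IsCritical

variable (hE : IsCritical E f k) (hEG : E ⊆ G.edgeFinset) (hf : ∀ v, 0 < f v) (hk : 0 < k)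
  (hdeg : ∀ v, G.degree v ≤ f v * k)
  (hP : IsPseudoforest (G.induce {v | G.degree v = f v * k}))

include hE hEG hf hk hdeg

theorem exists_degree_eq : ∃ v, G.degree v = f v * k := by
  obtain ⟨⟨x, w⟩, hxw⟩ := hE.nonempty hk
  have hEdeg (u) := (edgeDegree_le_degree hEG u).trans (hdeg u)
  obtain ⟨m, hm, -⟩ := hE.exists_saturated_ne (hf x) hEdeg hxw
  exact ⟨m, (degree_eq_and_edgeDegree_pos_of_mem_saturated hEG hf hk hdeg hm).1⟩

include hP

theorem card_adj_eq_two (hv : G.degree v = f v * k) (hpos : 0 < edgeDegree E v) :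
    #{z | (G.degree z = f z * k ∧ 0 < edgeDegree E z) ∧ G.Adj v z} = 2 := by
  rw [← filter_filter]
  refine hP.card_adj_eq_two (fun d hd => (mem_filter.1 hd).2.1) (fun d hd => ?_)
    (mem_filter.2 ⟨mem_univ v, hv, hpos⟩)
  rw [filter_filter]
  have hEdeg (u) := (edgeDegree_le_degree hEG u).trans (hdeg u)
  exact (hE.two_le_card_saturated (hf d) hEdeg (mem_filter.1 hd).2.2).trans
    (card_le_card (saturated_neighbors_subset hEG hf hk hdeg d))

theorem mem_saturatedVertices_of_degree_eq (hv : G.degree v = f v * k) (hpos : 0 < edgeDegree E v) :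
    v ∈ saturatedVertices E f k := by
  have hEdeg (u) := (edgeDegree_le_degree hEG u).trans (hdeg u)
  obtain ⟨w, hvw⟩ := edgeDegree_pos_iff.1 hpos
  obtain ⟨m, hm, -, hvm⟩ := hE.exists_saturated_ne (hf v) hEdeg hvw
  obtain ⟨hm_deg, hm_pos⟩ := degree_eq_and_edgeDegree_pos_of_mem_saturated hEG hf hk hdeg hm
  -- The saturated neighbours of `m` are already two, so they leave no room for another `v`.
  have hneighbors := eq_of_subset_of_card_le (saturated_neighbors_subset hEG hf hk hdeg m) <|
    (hE.card_adj_eq_two hEG hf hk hdeg hP hm_deg hm_pos).trans_le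
      (hE.two_le_card_saturated (hf m) hEdeg hm_pos)
  have hmv : G.Adj m v := (SimpleGraph.mem_edgeFinset.1 (hEG hvm)).symm
  exact (mem_filter.1 (hneighbors.ge (mem_filter.2 ⟨mem_univ v, ⟨hv, hpos⟩, hmv⟩))).1

theorem mul_le_edgeDegree_add_one (hpos : 0 < edgeDegree E w) :
    f w * k ≤ edgeDegree E w + 1 := by
  have hEdeg (u) := (edgeDegree_le_degree hEG u).trans (hdeg u)
  obtain ⟨z, hwz⟩ := edgeDegree_pos_iff.1 hpos
  obtain ⟨m, hm, -, hwm⟩ := hE.exists_saturated_ne (hf w) hEdeg hwz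
  rw [Sym2.eq_swap] at hwm
  obtain ⟨hm_deg, hm_pos⟩ := degree_eq_and_edgeDegree_pos_of_mem_saturated hEG hf hk hdeg hm
  have hlt := hE.lt_edgeDegree_add_card_saturated (hf m) hEdeg hwm
  have hle : #{z ∈ saturatedVertices E f k | z ≠ w ∧ s(m, z) ∈ E} ≤ 2 := by
    rw [← hE.card_adj_eq_two hEG hf hk hdeg hP hm_deg hm_pos]
    refine card_le_card (Subset.trans ?_ (saturated_neighbors_subset hEG hf hk hdeg m))
    exact monotone_filter_right _ fun z _ hz => hz.2
  lia

theorem edgeDegree_eq_degree_of_pos (hpos : 0 < edgeDegree E v) :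
    edgeDegree E v = G.degree v := by
  have hlow := hE.mul_le_edgeDegree_add_one hEG hf hk hdeg hP hpos
  have hle := edgeDegree_le_degree hEG v
  by_contra hne
  have hv : G.degree v = f v * k := by
    have := hdeg v
    lia
  have hsat := hE.mem_saturatedVertices_of_degree_eq hEG hf hk hdeg hP hv hpos
  rw [mem_saturatedVertices] at hsat
  exact hne (hsat.trans hv.symm)

theorem isRegularOfDegree_two (hG : G.Connected) :
    (G.induce {v | G.degree v = f v * k}).IsRegularOfDegree 2 := by
  rintro ⟨v, hv⟩
  have hEdeg := edgeDegree_eq_degree_of_connected hG hEG (hE.nonempty hk)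
    fun u hu => hE.edgeDegree_eq_degree_of_pos hEG hf hk hdeg hP hu
  have hpos {u} (hu : G.degree u = f u * k) : 0 < edgeDegree E u := by
    rw [hEdeg, hu]
    exact Nat.mul_pos (hf u) hk
  rw [← hE.card_adj_eq_two hEG hf hk hdeg hP hv (hpos hv),
    ← SimpleGraph.card_neighborFinset_eq_degree]
  refine card_bij (fun u _ => u) (fun u hu => ?_) (fun u _ u' _ h => Subtype.ext h) fun z hz => ?_
  · have hvu : G.Adj v u := ((G.induce _).mem_neighborFinset _ u).1 hu
    exact mem_filter.2 ⟨mem_univ _, ⟨u.2, hpos u.2⟩, hvu⟩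
  · obtain ⟨⟨hz, -⟩, hvz⟩ := (mem_filter.1 hz).2
    exact ⟨⟨z, hz⟩, (SimpleGraph.mem_neighborFinset _ _ _).2 hvz, rfl⟩

end IsCritical

end Critical

section FColorable

variable {V : Type*} [Fintype V] {G : SimpleGraph V} [DecidableRel G.Adj] {f : V → ℕ} {k : ℕ}

theorem fMaxDegree_le_iff (hf : ∀ v, 0 < f v) :
    fMaxDegree G f ≤ k ↔ ∀ v, G.degree v ≤ f v * k := by
  simp only [fMaxDegree, Finset.sup_le_iff, mem_univ, true_imp_iff, Nat.ceil_le]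
  refine forall_congr' fun v => ?_
  rw [div_le_iff₀' (by exact_mod_cast hf v)]
  norm_cast

theorem FColorable.degree_le (h : FColorable G f k) (v : V) : G.degree v ≤ f v * k := by
  classical
  obtain ⟨c, hc⟩ := h
  have hdegree : G.degree v = #{e : G.edgeSet | v ∈ (e : Sym2 V)} := by
    rw [← edgeDegree_edgeFinset, edgeDegree, ← card_image_of_injective _ Subtype.val_injective]
    congr 1
    ext e
    simp [and_comm]
  rw [hdegree, card_eq_sum_card_fiberwise (f := c) (t := univ) (by intro; simp)]
  refine (sum_le_card_nsmul univ _ (f v) fun i _ => ?_).trans (by simp [mul_comm])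
  have hcount := hc v i
  rwa [Nat.card_eq_fintype_card, Fintype.card_subtype, ← filter_filter] at hcount

theorem isFClassOne_of_fColorable (hf : ∀ v, 0 < f v) (h : FColorable G f (fMaxDegree G f)) :
    IsFClassOne G f :=
  le_antisymm (Nat.sInf_le h)
    ((fMaxDegree_le_iff hf).2 (fColorable_fChromaticIndex G f hf).degree_le)

theorem IsEdgeColoring.fColorable [DecidableEq V] {c : Sym2 V → Fin k}
    (h : IsEdgeColoring G.edgeFinset f c) : FColorable G f k := by
  classical
  refine ⟨fun e => c e, fun v i => le_trans ?_ (h v i)⟩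
  rw [Nat.card_eq_fintype_card, Fintype.card_subtype]
  refine card_le_card_of_injOn Subtype.val (fun e he => ?_) Subtype.val_injective.injOn
  exact mem_edgesOfColor.2 ⟨SimpleGraph.mem_edgeFinset.2 e.2, (mem_filter.1 he).2⟩

theorem fColorable_zero_of_degree_eq_zero (hdeg : ∀ v, G.degree v = 0) : FColorable G f 0 := by
  have hempty : IsEmpty G.edgeSet := by
    constructor
    rintro ⟨⟨v, w⟩, hvw⟩
    exact ((G.degree_pos_iff_exists_adj v).2 ⟨w, hvw⟩).ne' (hdeg v)
  exact ⟨isEmptyElim, fun _ i => i.elim0⟩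

theorem fColorable_of_isPseudoforest (hG : G.Connected) (hf : ∀ v, 0 < f v)
    (hdeg : ∀ v, G.degree v ≤ f v * k)
    (hP : IsPseudoforest (G.induce {v | G.degree v = f v * k}))
    (hreg : ¬ ((∃ v, G.degree v = f v * k) ∧
      (G.induce {v | G.degree v = f v * k}).IsRegularOfDegree 2)) :
    FColorable G f k := by
  classical
  obtain rfl | hk := Nat.eq_zero_or_pos k
  · exact fColorable_zero_of_degree_eq_zero fun v => Nat.le_zero.1 (hdeg v)
  by_contra hcol
  have hE : ¬ IsEdgeColorable G.edgeFinset f (Fin k) := fun ⟨_, hc⟩ => hcol hc.fColorable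
  obtain ⟨E, hEG, hE⟩ := exists_isCritical_subset hE
  exact hreg ⟨hE.exists_degree_eq hEG hf hk hdeg,
    hE.isRegularOfDegree_two hEG hf hk hdeg hP hG⟩

end FColorable

end FColoring

theorem mainTheorem2 {V : Type*} [Fintype V] (G : SimpleGraph V) [DecidableRel G.Adj]
    (f : V → ℕ) (hf : ∀ v, 0 < f v) (hG : G.Connected)
    (hcore : ∀ C : (FColoring.fCore G f).ConnectedComponent,
      C.toSimpleGraph.IsTree ∨ FColoring.IsUnicyclic C.toSimpleGraph)
    (hreg : ¬ ((FColoring.fMaxVertices G f).Nonempty ∧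
      (FColoring.fCore G f).IsRegularOfDegree 2)) :
    FColoring.IsFClassOne G f :=
  FColoring.isFClassOne_of_fColorable hf <|
    FColoring.fColorable_of_isPseudoforest hG hf ((FColoring.fMaxDegree_le_iff hf).1 le_rfl)
      (FColoring.isPseudoforest_of_isTree_or_isUnicyclic hcore) hreg
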